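/- \textbf{Proposition (Central limit theorem).} Let $(x_{ij})_{i,j\ge 1}$ be independent, identically distributed real random variables with mean zero, variance one and all moments finite ($\mathbf{E}|x_{11}|^k<\infty$ for every $k\in\mathbb{N}$), and for each $n\ge 1$ let $X_n=(x_{ij})_{1\le i,j\le n}$. For each $n \ge 1$ let $u_n,v_n\in\mathbb{R}^n$ be deterministic unit vectors (in the Euclidean norm) whose coefficients are asymptotically delocalised: there is a constant $C$ independent of $n$ such that $$\sup_{1\le i\le n}|u_{n,i}|\le \frac{C}{\sqrt n},\qquad \sup_{1\le i\le n}|v_{n,i}|\le \frac{C}{\sqrt n}\qquad\text{for all } n\ge 1.$$ Then for any fixed $m\ge 1$, the $m$ random variables $$Z_{n,j}:=\sqrt n\,\Big\langle \Big(\tfrac{1}{\sqrt n}X_n\Big)^j u_n,\,v_n\Big\rangle,\qquad j=1,\dots,m,$$ converge jointly in distribution as $n\to\infty$ to $m$ independent copies of the standard real Gaussian $N(0,1)_{\mathbb{R}}$; that is, the law of $(Z_{n,1},\dots,Z_{n,m})$ on $\mathbb{R}^m$ converges weakly to the product measure $N(0,1)_{\mathbb{R}}^{\otimes m}$. -/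

import Mathlib

open MeasureTheory ProbabilityTheory Filter

/-- A (nested) real iid random matrix with atom distribution `ν`: a doubly infinite array of jointly
independent real random variables, each of law `ν`, where `ν` has mean zero and variance one.
(`variance_one` forces `t ↦ t ^ 2`, hence also `t ↦ t`, to be `ν`-integrable.) -/
structure IsIIDRandomMatrix {Ω : Type*} [MeasurableSpace Ω] (P : Measure Ω)
    (x : ℕ → ℕ → Ω → ℝ) (ν : Measure ℝ) : Prop where
  hasLaw : ∀ i j, HasLaw (x i j) ν P
  indep : iIndepFun (fun p : ℕ × ℕ => x p.1 p.2) P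
  mean_zero : ∫ t, t ∂ν = 0
  variance_one : ∫ t, t ^ 2 ∂ν = 1

/-- The `n × n` random matrix `X_n`: the top left corner of the infinite array (indices start
at `0`). -/
def cornerMatrix {Ω : Type*} (x : ℕ → ℕ → Ω → ℝ) (n : ℕ) (ω : Ω) : Matrix (Fin n) (Fin n) ℝ :=
  Matrix.of fun i j => x i j ω

/-- Asymptotic delocalisation: `sup_i |u_{n,i}| = O(1/√n)`. -/
def AsymptoticallyDelocalised (u : (n : ℕ) → EuclideanSpace ℝ (Fin n)) : Prop :=
  ∃ C : ℝ, ∀ (n : ℕ) (i : Fin n), |u n i| ≤ C / √(n : ℝ)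

/-- The random variable `√n ⟨(X_n / √n)^j u_n, v_n⟩`. -/
noncomputable def scaledCoefficient {Ω : Type*} (x : ℕ → ℕ → Ω → ℝ)
    (u v : (n : ℕ) → EuclideanSpace ℝ (Fin n)) (j n : ℕ) (ω : Ω) : ℝ :=
  √(n : ℝ) * inner ℝ
    (Matrix.toEuclideanLin (((1 / √(n : ℝ)) • cornerMatrix x n ω) ^ j) (u n)) (v n)

/-! By Cramér–Wold it suffices to treat one linear combination `∑ t_j Z_{n,j}`. Expanding matrix
powers over paths makes it a `pathPolynomial` in the entries, with one monomial per path;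
delocalisation makes each weight `O(n^{-s/2})`, where `s` is the number of vertex slots of the path.
It is compared with `pathLinearForm`, in which the monomial of each path is replaced by its own
independent standard Gaussian: that form is exactly Gaussian, of variance `∑ t_j ^ 2`.

The `k`-th moments of both are sums over `k`-tuples of paths. A tuple contributes to the first only
if every edge is repeated, and to the second only if every path is repeated; either condition forces
every vertex value to be repeated. If moreover no vertex value occurs three times, the two
conditions coincide and both expectations are 1 (`HasTwins.pathLabel_of_pathEdge`,
`labelledMoment_pathEdge_eq_pathLabel`). The remaining tuples have fewer than half as many distinct
vertices as vertex slots, so they contribute `O(1/√n)` in total (`card_not_atMostTwoToOne_mul_le`).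

Moments therefore converge to Gaussian ones, and the exponential moment of the Gaussian upgrades
this to characteristic functions (`tendsto_integral_cexp_of_tendsto_moments`). -/

/-! ### Taylor remainders and the method of moments. -/

lemma norm_cexp_ofReal_mul_I_sub_sum_le_of_nonneg (n : ℕ) :
    ∀ x : ℝ, 0 ≤ x → ‖Complex.exp (x * Complex.I) -
      ∑ k ∈ Finset.range n, (x * Complex.I) ^ k / (k.factorial : ℂ)‖ ≤ x ^ n / n.factorial := by
  induction n with
  | zero => intro x _; simp [Complex.norm_exp_ofReal_mul_I]
  | succ n ih =>
    intro x hx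
    set f : ℝ → ℂ := fun y => Complex.exp (y * Complex.I) -
      ∑ k ∈ Finset.range (n + 1), (y * Complex.I) ^ k / (k.factorial : ℂ) with hf
    have hlin : ∀ y : ℝ, HasDerivAt (fun z : ℝ => (z : ℂ) * Complex.I) Complex.I y := fun y => by
      simpa using (Complex.ofRealCLM.hasDerivAt (x := y)).mul_const Complex.I
    have hfd : ∀ y : ℝ, HasDerivAt f (Complex.I * (Complex.exp (y * Complex.I) -
        ∑ k ∈ Finset.range n, (y * Complex.I) ^ k / (k.factorial : ℂ))) y := by
      intro y
      have h1 := (hlin y).cexp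
      have h2 : HasDerivAt (fun y : ℝ =>
          ∑ k ∈ Finset.range (n + 1), ((y : ℂ) * Complex.I) ^ k / (k.factorial : ℂ))
          (∑ k ∈ Finset.range (n + 1),
            ((k : ℂ) * (y * Complex.I) ^ (k - 1) * Complex.I) / (k.factorial : ℂ)) y :=
        HasDerivAt.fun_sum fun k _ => ((hlin y).pow k).div_const _
      refine (h1.sub h2).congr_deriv ?_
      rw [Finset.sum_range_succ', mul_sub, mul_comm Complex.I, Finset.mul_sum]
      simp only [Nat.cast_zero, zero_mul, zero_div, add_zero]
      congr 1
      refine Finset.sum_congr rfl fun k _ => ?_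
      have hk : (k.factorial : ℂ) ≠ 0 := by exact_mod_cast k.factorial_ne_zero
      have hk' : ((k : ℂ) + 1) ≠ 0 := by exact_mod_cast k.succ_ne_zero
      simp only [Nat.factorial_succ, Nat.add_sub_cancel]
      push_cast
      field_simp
    have hB : ∀ y : ℝ, HasDerivAt (fun y : ℝ => y ^ (n + 1) / ((n + 1).factorial : ℝ))
        (y ^ n / n.factorial) y := by
      intro y
      refine (((hasDerivAt_id y).pow (n + 1)).div_const ((n + 1).factorial : ℝ)).congr_deriv ?_
      have hk : (n.factorial : ℝ) ≠ 0 := by exact_mod_cast n.factorial_ne_zero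
      have hk' : ((n : ℝ) + 1) ≠ 0 := by exact_mod_cast n.succ_ne_zero
      simp only [Nat.factorial_succ, Nat.add_sub_cancel, id]
      push_cast
      field_simp
    -- The derivative of each remainder is `I` times the previous one, so the inductive bound
    -- integrates from 0.
    refine image_norm_le_of_norm_deriv_right_le_deriv_boundary (f := f) (a := 0) (b := x)
      (fun y _ => (hfd y).continuousAt.continuousWithinAt)
      (fun y _ => (hfd y).hasDerivWithinAt) ?_ hB ?_ ⟨hx, le_rfl⟩
    · simp [hf, Finset.sum_range_succ']
    · intro y hy
      rw [norm_mul, Complex.norm_I, one_mul]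
      exact ih y hy.1

lemma norm_cexp_ofReal_mul_I_sub_sum_le (n : ℕ) (x : ℝ) :
    ‖Complex.exp (x * Complex.I) -
      ∑ k ∈ Finset.range n, (x * Complex.I) ^ k / (k.factorial : ℂ)‖ ≤ |x| ^ n / n.factorial := by
  rcases le_total 0 x with hx | hx
  · simpa [abs_of_nonneg hx] using norm_cexp_ofReal_mul_I_sub_sum_le_of_nonneg n x hx
  · have h := norm_cexp_ofReal_mul_I_sub_sum_le_of_nonneg n (-x) (by linarith)
    rw [abs_of_nonpos hx]
    refine le_trans (le_of_eq ?_) h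
    rw [← Complex.norm_conj]
    simp [map_sub, map_sum, ← Complex.exp_conj, map_div₀]

lemma tendsto_integral_abs_pow_div_factorial {γ : Measure ℝ}
    (hexp : Integrable (fun y : ℝ => Real.exp |y|) γ) :
    Tendsto (fun n : ℕ => ∫ y, |y| ^ n / (n.factorial : ℝ) ∂γ) atTop (nhds 0) := by
  rw [← integral_zero ℝ ℝ (μ := γ)]
  refine tendsto_integral_of_dominated_convergence (fun y => Real.exp |y|)
    (fun n => by fun_prop) hexp (fun n => ae_of_all _ fun y => ?_) (ae_of_all _ fun y => ?_)
  · rw [Real.norm_of_nonneg (by positivity)]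
    exact Real.pow_div_factorial_le_exp _ (abs_nonneg y) n
  · exact FloorSemiring.tendsto_pow_div_factorial_atTop _

/-- Evenness of `n` makes the Taylor error a genuine moment rather than an absolute one, so that
convergence of moments controls it. -/
lemma norm_integral_cexp_sub_sum_moments_le {Ω : Type*} [MeasurableSpace Ω] {P : Measure Ω}
    [IsProbabilityMeasure P] {S : Ω → ℝ} (hS : AEMeasurable S P)
    (hint : ∀ k : ℕ, Integrable (fun ω => S ω ^ k) P) (n : ℕ) (hn : Even n) :
    ‖∫ ω, Complex.exp (S ω * Complex.I) ∂P -
      ∑ k ∈ Finset.range n, ((∫ ω, S ω ^ k ∂P : ℝ) : ℂ) * (Complex.I ^ k / (k.factorial : ℂ))‖ ≤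
      ∫ ω, S ω ^ n / n.factorial ∂P := by
  have hint' : ∀ k : ℕ, Integrable (fun ω => ((S ω : ℂ) * Complex.I) ^ k / (k.factorial : ℂ)) P := by
    intro k
    have := ((hint k).ofReal (𝕜 := ℂ)).mul_const (Complex.I ^ k / (k.factorial : ℂ))
    refine this.congr (ae_of_all _ fun ω => ?_)
    simp [mul_pow, mul_div_assoc]
  have hexp : Integrable (fun ω => Complex.exp (S ω * Complex.I)) P := by
    refine Integrable.of_bound (by fun_prop) 1 (ae_of_all _ fun ω => ?_)
    rw [Complex.norm_exp_ofReal_mul_I]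
  have h1 : ∑ k ∈ Finset.range n, ((∫ ω, S ω ^ k ∂P : ℝ) : ℂ) * (Complex.I ^ k / (k.factorial : ℂ)) =
      ∫ ω, ∑ k ∈ Finset.range n, ((S ω : ℂ) * Complex.I) ^ k / (k.factorial : ℂ) ∂P := by
    rw [integral_finsetSum _ fun k _ => hint' k]
    refine Finset.sum_congr rfl fun k _ => ?_
    rw [← integral_complex_ofReal, ← integral_mul_const]
    refine integral_congr_ae (ae_of_all _ fun ω => ?_)
    simp [mul_pow, mul_div_assoc]
  rw [h1, ← integral_sub hexp (integrable_finsetSum _ fun k _ => hint' k)]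
  refine norm_integral_le_of_norm_le ((hint n).div_const _) (ae_of_all _ fun ω => ?_)
  simpa [hn.pow_abs] using norm_cexp_ofReal_mul_I_sub_sum_le n (S ω)

/-- The method of moments for a limit law with an exponential moment. -/
lemma tendsto_integral_cexp_of_tendsto_moments {Ω : Type*} [MeasurableSpace Ω] {P : Measure Ω}
    [IsProbabilityMeasure P] {S : ℕ → Ω → ℝ} (hS : ∀ n, AEMeasurable (S n) P)
    (hint : ∀ n, ∀ k : ℕ, Integrable (fun ω => S n ω ^ k) P)
    {γ : Measure ℝ} [IsProbabilityMeasure γ]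
    (hexp : Integrable (fun y : ℝ => Real.exp |y|) γ)
    (hlim : ∀ k : ℕ, Tendsto (fun n => ∫ ω, S n ω ^ k ∂P) atTop (nhds (∫ y, y ^ k ∂γ))) :
    Tendsto (fun n => ∫ ω, Complex.exp (S n ω * Complex.I) ∂P) atTop
      (nhds (∫ y : ℝ, Complex.exp (y * Complex.I) ∂γ)) := by
  have hγ : ∀ k : ℕ, Integrable (fun y : ℝ => y ^ k) γ := by
    intro k
    refine (hexp.const_mul (k.factorial : ℝ)).mono' (by fun_prop) (ae_of_all _ fun y => ?_)
    rw [norm_pow, Real.norm_eq_abs, ← div_le_iff₀' (by positivity)]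
    exact Real.pow_div_factorial_le_exp _ (abs_nonneg y) k
  rw [Metric.tendsto_atTop']
  intro ε hε
  obtain ⟨N, hN⟩ := (Metric.tendsto_atTop.1 (tendsto_integral_abs_pow_div_factorial hexp))
    (ε / 4) (by positivity)
  set K := 2 * N with hK
  have hKe : Even K := even_two_mul N
  have hγK : ∫ y, y ^ K / (K.factorial : ℝ) ∂γ < ε / 4 := by
    have := hN K (by omega)
    simp only [hKe.pow_abs, Real.dist_eq, sub_zero] at this
    exact lt_of_abs_lt this
  -- The order `K` was fixed using `γ` alone; convergence of the `K`-th moment carries the error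
  -- bound over to `S n`.
  have hSK : ∀ᶠ n in atTop, ∫ ω, S n ω ^ K / (K.factorial : ℝ) ∂P < ε / 4 := by
    have h := (hlim K).div_const (K.factorial : ℝ)
    simp only [← integral_div] at h
    exact h.eventually_lt_const hγK
  have hpoly : Tendsto (fun n => ∑ k ∈ Finset.range K,
      ((∫ ω, S n ω ^ k ∂P : ℝ) : ℂ) * (Complex.I ^ k / (k.factorial : ℂ))) atTop
      (nhds (∑ k ∈ Finset.range K,
        ((∫ y, y ^ k ∂γ : ℝ) : ℂ) * (Complex.I ^ k / (k.factorial : ℂ)))) :=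
    tendsto_finsetSum _ fun k _ =>
      ((Complex.continuous_ofReal.tendsto _).comp (hlim k)).mul_const _
  have hpoly' := (Metric.tendsto_nhds.1 hpoly) (ε / 4) (by positivity)
  obtain ⟨M, hM⟩ := (hSK.and hpoly').exists_forall_of_atTop
  refine ⟨M, fun n hn => ?_⟩
  obtain ⟨h1, h2⟩ := hM n hn.le
  have h3 := norm_integral_cexp_sub_sum_moments_le (hS n) (hint n) K hKe
  have h4 := norm_integral_cexp_sub_sum_moments_le (P := γ) (S := fun y => y) aemeasurable_id hγ K hKe
  rw [← dist_eq_norm] at h3 h4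
  rw [dist_comm] at h4
  refine (dist_triangle4 _ _ _ _).trans_lt
    ((add_lt_add (add_lt_add (h3.trans_lt h1) h2) (h4.trans_lt hγK)).trans ?_)
  linarith

/-! ### Expectations of products of independent variables with repetitions. -/

/-- Every fibre that is hit is hit at least twice. -/
def HasTwins {E Q : Type*} (φ : E → Q) : Prop := ∀ e, ∃ e', e' ≠ e ∧ φ e' = φ e

/-- Every fibre has at most two elements. -/
def AtMostTwoToOne {E Q : Type*} (φ : E → Q) : Prop :=
  ∀ a b c, φ a = φ b → φ a = φ c → a = b ∨ a = c ∨ b = c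

open Classical in
/-- The expectation of `∏ e, Y (φ e)` for an independent family `Y` of variables of law `ν`. -/
noncomputable def labelledMoment {E Q : Type*} [Fintype E] (ν : Measure ℝ) (φ : E → Q) : ℝ :=
  ∏ q ∈ Finset.univ.image φ, ∫ t, t ^ (Finset.univ.filter fun e => φ e = q).card ∂ν

section
variable {E Q : Type*} [Fintype E]

lemma labelledMoment_eq_zero {ν : Measure ℝ} (hν : ∫ t, t ∂ν = 0) {φ : E → Q}
    (h : ¬ HasTwins φ) : labelledMoment ν φ = 0 := by
  classical
  simp only [HasTwins, not_forall, not_exists, not_and] at h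
  obtain ⟨e, he⟩ := h
  refine Finset.prod_eq_zero (Finset.mem_image_of_mem φ (Finset.mem_univ e)) ?_
  have : (Finset.univ.filter fun e' => φ e' = φ e) = {e} := by
    ext e'
    simp only [Finset.mem_filter, Finset.mem_univ, true_and, Finset.mem_singleton]
    exact ⟨fun h' => by_contra fun hne => he e' hne h', fun h' => by rw [h']⟩
  rw [show (Finset.univ.filter fun e' => φ e' = φ e).card = 1 by simp [this]]
  simpa using hν

lemma labelledMoment_eq_one {ν : Measure ℝ} (hν : ∫ t, t ^ 2 ∂ν = 1) {φ : E → Q}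
    (h : HasTwins φ) (h' : AtMostTwoToOne φ) : labelledMoment ν φ = 1 := by
  classical
  refine Finset.prod_eq_one fun q hq => ?_
  obtain ⟨e, -, rfl⟩ := Finset.mem_image.1 hq
  obtain ⟨e', hne, he'⟩ := h e
  have : (Finset.univ.filter fun a => φ a = φ e) = {e, e'} := by
    ext a
    simp only [Finset.mem_filter, Finset.mem_univ, true_and, Finset.mem_insert,
      Finset.mem_singleton]
    constructor
    · intro ha
      rcases h' a e e' ha (ha.trans he'.symm) with h1 | h1 | h1
      · exact Or.inl h1
      · exact Or.inr h1
      · exact absurd h1.symm hne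
    · rintro (rfl | rfl)
      · rfl
      · exact he'
  rw [show (Finset.univ.filter fun a => φ a = φ e).card = 2 by
    simpa [this] using Finset.card_pair hne.symm]
  exact hν

/-- Fibre sizes are at most the cardinality of `E`, so only finitely many moments of `ν` occur. The
bound does not depend on `Q`, hence later not on `n`. -/
lemma abs_labelledMoment_le (E : Type*) [Fintype E] (ν : Measure ℝ) :
    ∃ B : ℝ, 0 ≤ B ∧ ∀ {Q : Type*} (φ : E → Q), |labelledMoment ν φ| ≤ B := by
  classical
  set b : ℝ := 1 + ∑ k ∈ Finset.range (Fintype.card E + 1), |∫ t, t ^ k ∂ν|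
  have hb : 1 ≤ b := le_add_of_nonneg_right (Finset.sum_nonneg fun _ _ => abs_nonneg _)
  refine ⟨b ^ Fintype.card E, by positivity, fun {Q} φ => ?_⟩
  rw [labelledMoment, Finset.abs_prod]
  refine (Finset.prod_le_prod (g := fun _ => b) (fun _ _ => abs_nonneg _) fun q _ => ?_).trans
    ((Finset.prod_const b).trans_le (pow_le_pow_right₀ hb Finset.card_image_le))
  refine le_add_of_nonneg_of_le zero_le_one ?_
  refine Finset.single_le_sum (f := fun k => |∫ t, t ^ k ∂ν|) (fun _ _ => abs_nonneg _) ?_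
  rw [Finset.mem_range, Nat.lt_succ_iff]
  exact Finset.card_le_univ _

lemma two_mul_card_image_lt {φ : E → Q} [DecidableEq Q] (h : HasTwins φ)
    (h' : ¬ AtMostTwoToOne φ) :
    2 * (Finset.univ.image φ).card + 1 ≤ Fintype.card E := by
  classical
  rw [← Finset.card_univ, Finset.card_eq_sum_card_image φ, Nat.succ_le_iff, mul_comm,
    ← smul_eq_mul, ← Finset.sum_const]
  simp only [AtMostTwoToOne, not_forall, not_or] at h'
  obtain ⟨a, b, c, hab, hac, h1, h2, h3⟩ := h'
  refine Finset.sum_lt_sum (fun q hq => ?_)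
    ⟨φ a, Finset.mem_image_of_mem φ (Finset.mem_univ a), ?_⟩
  · obtain ⟨e, -, rfl⟩ := Finset.mem_image.1 hq
    obtain ⟨e', hne, he'⟩ := h e
    exact Finset.one_lt_card.2 ⟨e', by simpa using he', e, by simp, hne⟩
  · exact Finset.two_lt_card.2 ⟨a, by simp, b, by simp [hab], c, by simp [hac], h1, h2, h3⟩

variable {Ω : Type*} [MeasurableSpace Ω] {P : Measure Ω} {ν : Measure ℝ} {Y : Q → Ω → ℝ}

lemma memLp_natCast_of_integrable_abs_pow (hν : ∀ k : ℕ, Integrable (fun t : ℝ => |t| ^ k) ν)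
    (k : ℕ) : MemLp (fun t : ℝ => t) k ν := by
  rcases eq_or_ne k 0 with rfl | hk
  · simpa using! aestronglyMeasurable_id
  · rw [← integrable_norm_rpow_iff (by fun_prop) (by exact_mod_cast hk) (by simp)]
    simpa using hν k

lemma integrable_prod_comp [IsFiniteMeasure P] (hY : ∀ q, HasLaw (Y q) ν P)
    (hν : ∀ k : ℕ, Integrable (fun t : ℝ => |t| ^ k) ν) (φ : E → Q) :
    Integrable (fun ω => ∏ e, Y (φ e) ω) P := by
  rcases isEmpty_or_nonempty E with hE | hE
  · simp
  -- Hölder: a product of `p` functions in `L^p` lies in `L^1`.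
  · have hm : ∀ e ∈ (Finset.univ : Finset E), MemLp (Y (φ e)) (Fintype.card E : ℕ) P := by
      intro e _
      have h := memLp_natCast_of_integrable_abs_pow hν (Fintype.card E)
      rw [← (hY (φ e)).map_eq] at h
      exact h.comp_of_map (hY (φ e)).aemeasurable
    have h := MemLp.prod' hm
    rw [← memLp_one_iff_integrable]
    convert h
    have : (Fintype.card E : ENNReal) ≠ 0 := by exact_mod_cast Fintype.card_ne_zero
    simp [ENNReal.mul_inv_cancel this (by simp)]

lemma integral_prod_comp_eq_labelledMoment (hY : ∀ q, HasLaw (Y q) ν P) (hind : iIndepFun Y P)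
    (φ : E → Q) : ∫ ω, ∏ e, Y (φ e) ω ∂P = labelledMoment ν φ := by
  classical
  have h1 : ∀ ω, ∏ e : E, Y (φ e) ω = ∏ q : (Finset.univ.image φ),
      (fun t : ℝ => t ^ (Finset.univ.filter fun e => φ e = q).card) (Y q ω) := by
    intro ω
    exact (Finset.prod_comp (fun q => Y q ω) φ).trans (Finset.prod_coe_sort _ fun q : Q =>
      Y q ω ^ (Finset.univ.filter fun e => φ e = q).card).symm
  simp_rw [h1]
  rw [(hind.precomp (g := fun q : Finset.univ.image φ => (q : Q))
    Subtype.val_injective).integral_fun_prod_comp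
    (f := fun (q : (Finset.univ.image φ)) (t : ℝ) => t ^ (Finset.univ.filter fun e => φ e = q).card)
    (fun q => (hY q).aemeasurable) (fun q => by fun_prop), labelledMoment]
  refine Eq.trans (Finset.prod_congr rfl fun q _ => ?_) (Finset.prod_coe_sort _ fun q : Q =>
    ∫ t, t ^ (Finset.univ.filter fun e => φ e = q).card ∂ν)
  exact (hY q).integral_comp (f := fun t : ℝ => t ^ (Finset.univ.filter fun e => φ e = q).card)
    (by fun_prop)
end

/-! ### Families of paths: repeated vertices, edges and paths. -/

section
variable {ι V : Type*}

lemma sigma_fin_ext_iff {N : ι → ℕ} (a b : Σ l, Fin (N l)) :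
    a = b ↔ a.1 = b.1 ∧ (a.2 : ℕ) = b.2 := by
  obtain ⟨l, r⟩ := a
  obtain ⟨l', r'⟩ := b
  constructor
  · rintro h
    cases h
    exact ⟨rfl, rfl⟩
  · rintro ⟨h, h'⟩
    dsimp only at h h'
    subst h
    rw [Fin.ext h']

lemma sigma_fin_pi_ext_iff {K : Type*} {N : K → ℕ} (a b : Σ j, (Fin (N j) → V)) :
    a = b ↔ a.1 = b.1 ∧ ∀ r (h : r < N a.1) (h' : r < N b.1), a.2 ⟨r, h⟩ = b.2 ⟨r, h'⟩ := by
  obtain ⟨l, f⟩ := a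
  obtain ⟨l', f'⟩ := b
  constructor
  · rintro h
    cases h
    exact ⟨rfl, fun _ _ _ => rfl⟩
  · rintro ⟨h, h'⟩
    dsimp only at h h'
    subst h
    rw [show f = f' from funext fun r => h' r r.2 r.2]

variable {m : ℕ}

/-- The value at each vertex slot of a family of paths, the path `l` having `J l + 1` edges. -/
def pathVertex (J : ι → Fin m) (f : ∀ l, Fin ((J l : ℕ) + 1 + 1) → V) :
    (Σ l, Fin ((J l : ℕ) + 1 + 1)) → V := fun s => f s.1 s.2

/-- The directed edge at each edge slot of a family of paths. -/
def pathEdge (J : ι → Fin m) (f : ∀ l, Fin ((J l : ℕ) + 1 + 1) → V) :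
    (Σ l, Fin ((J l : ℕ) + 1)) → V × V := fun e => (f e.1 e.2.castSucc, f e.1 e.2.succ)

/-- The paths of a family, as elements of the type of all paths with at most `m` edges. -/
def pathLabel (J : ι → Fin m) (f : ∀ l, Fin ((J l : ℕ) + 1 + 1) → V) :
    ι → Σ j : Fin m, (Fin ((j : ℕ) + 1 + 1) → V) := fun l => ⟨J l, f l⟩

variable {J : ι → Fin m} {f : ∀ l, Fin ((J l : ℕ) + 1 + 1) → V}

lemma pathLabel_eq_iff {l l' : ι} : pathLabel J f l = pathLabel J f l' ↔ J l = J l' ∧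
    ∀ r (h : r < (J l : ℕ) + 1 + 1) (h' : r < (J l' : ℕ) + 1 + 1), f l ⟨r, h⟩ = f l' ⟨r, h'⟩ :=
  sigma_fin_pi_ext_iff (N := fun j : Fin m => (j : ℕ) + 1 + 1) _ _

/-- Each edge slot has a distinct edge slot with the same start and the same end. -/
lemma hasTwins_pathEdge_iff : HasTwins (pathEdge J f) ↔
    ∀ l r (h : r < (J l : ℕ) + 1), ∃ l' r', ∃ h' : r' < (J l' : ℕ) + 1, ¬ (l' = l ∧ r' = r) ∧
      f l' ⟨r', by omega⟩ = f l ⟨r, by omega⟩ ∧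
      f l' ⟨r' + 1, by omega⟩ = f l ⟨r + 1, by omega⟩ := by
  constructor
  · intro H l r h
    obtain ⟨⟨l', r'⟩, hne, he⟩ := H ⟨l, ⟨r, h⟩⟩
    rw [Ne, sigma_fin_ext_iff (N := fun l => (J l : ℕ) + 1)] at hne
    exact ⟨l', r', r'.2, hne, congrArg Prod.fst he, congrArg Prod.snd he⟩
  · rintro H ⟨l, ⟨r, h⟩⟩
    obtain ⟨l', r', h', hne, he, he'⟩ := H l r h
    refine ⟨⟨l', ⟨r', h'⟩⟩, ?_, Prod.ext he he'⟩
    rw [Ne, sigma_fin_ext_iff (N := fun l => (J l : ℕ) + 1)]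
    exact hne

lemma HasTwins.pathVertex_of_pathEdge (H : HasTwins (pathEdge J f)) :
    HasTwins (pathVertex J f) := by
  rw [hasTwins_pathEdge_iff] at H
  rintro ⟨l, ⟨r, h⟩⟩
  rcases lt_or_ge r ((J l : ℕ) + 1) with hr | hr
  · obtain ⟨l', r', h', hne, he, -⟩ := H l r hr
    refine ⟨⟨l', ⟨r', by omega⟩⟩, ?_, he⟩
    rwa [Ne, sigma_fin_ext_iff (N := fun l => (J l : ℕ) + 1 + 1)]
  -- The last vertex starts no edge, so the edge entering it is used instead.
  · obtain rfl : r = (J l : ℕ) + 1 := by omega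
    obtain ⟨l', r', h', hne, -, he⟩ := H l (J l : ℕ) (by omega)
    refine ⟨⟨l', ⟨r' + 1, by omega⟩⟩, ?_, he⟩
    rw [Ne, sigma_fin_ext_iff (N := fun l => (J l : ℕ) + 1 + 1)]
    simpa using hne

lemma HasTwins.pathEdge_of_pathLabel (H : HasTwins (pathLabel J f)) :
    HasTwins (pathEdge J f) := by
  rw [hasTwins_pathEdge_iff]
  intro l r h
  obtain ⟨l', hne, he⟩ := H l
  rw [pathLabel_eq_iff] at he
  have hr : r < (J l' : ℕ) + 1 := by rw [he.1]; exact h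
  exact ⟨l', r, hr, fun h => hne h.1, he.2 _ _ _, he.2 _ _ _⟩

/-- An edge slot is determined by its starting vertex slot. -/
lemma AtMostTwoToOne.pathEdge (H : AtMostTwoToOne (pathVertex J f)) :
    AtMostTwoToOne (pathEdge J f) := by
  have key : ∀ a b : Σ l, Fin ((J l : ℕ) + 1),
      (⟨a.1, a.2.castSucc⟩ : Σ l, Fin ((J l : ℕ) + 1 + 1)) = ⟨b.1, b.2.castSucc⟩ → a = b := by
    intro a b h
    rw [sigma_fin_ext_iff (N := fun l => (J l : ℕ) + 1 + 1)] at h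
    exact (sigma_fin_ext_iff (N := fun l => (J l : ℕ) + 1) a b).2 h
  intro a b c hab hac
  exact (H ⟨a.1, a.2.castSucc⟩ ⟨b.1, b.2.castSucc⟩ ⟨c.1, c.2.castSucc⟩
    (congrArg Prod.fst hab) (congrArg Prod.fst hac)).imp (key a b) (Or.imp (key a c) (key b c))

lemma AtMostTwoToOne.pathLabel (H : AtMostTwoToOne (pathVertex J f)) :
    AtMostTwoToOne (pathLabel J f) := by
  intro a b c hab hac
  rw [pathLabel_eq_iff] at hab hac
  rcases H ⟨a, 0⟩ ⟨b, 0⟩ ⟨c, 0⟩ (hab.2 0 _ _) (hac.2 0 _ _) with h | h | h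
  · exact Or.inl (congrArg Sigma.fst h)
  · exact Or.inr (Or.inl (congrArg Sigma.fst h))
  · exact Or.inr (Or.inr (congrArg Sigma.fst h))

/-- When no vertex value is taken three times, paired edges force paired paths. -/
lemma HasTwins.pathLabel_of_pathEdge (H : HasTwins (pathEdge J f))
    (H2 : AtMostTwoToOne (pathVertex J f)) : HasTwins (pathLabel J f) := by
  rw [hasTwins_pathEdge_iff] at H
  have two : ∀ {l r l' r' l'' r''} (h : r < (J l : ℕ) + 1 + 1) (h' : r' < (J l' : ℕ) + 1 + 1)
      (h'' : r'' < (J l'' : ℕ) + 1 + 1), f l' ⟨r', h'⟩ = f l ⟨r, h⟩ →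
      f l'' ⟨r'', h''⟩ = f l ⟨r, h⟩ → ¬ (l' = l ∧ r' = r) → ¬ (l'' = l ∧ r'' = r) →
      l'' = l' ∧ r'' = r' := by
    intro l r l' r' l'' r'' h h' h'' e e' hne hne'
    have := H2 ⟨l, ⟨r, h⟩⟩ ⟨l', ⟨r', h'⟩⟩ ⟨l'', ⟨r'', h''⟩⟩ e.symm e'.symm
    simp only [sigma_fin_ext_iff (N := fun l => (J l : ℕ) + 1 + 1)] at this
    rcases this with h | h | h
    · exact absurd ⟨h.1.symm, h.2.symm⟩ hne
    · exact absurd ⟨h.1.symm, h.2.symm⟩ hne'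
    · exact ⟨h.1.symm, h.2.symm⟩
  -- following an edge out of a pair of equal vertices
  have step : ∀ {l r l' r'} (h : r < (J l : ℕ) + 1) (h' : r' < (J l' : ℕ) + 1 + 1),
      f l' ⟨r', h'⟩ = f l ⟨r, by omega⟩ → ¬ (l' = l ∧ r' = r) →
      ∃ h'' : r' + 1 < (J l' : ℕ) + 1 + 1, f l' ⟨r' + 1, h''⟩ = f l ⟨r + 1, by omega⟩ := by
    intro l r l' r' h h' e hne
    obtain ⟨a, b, hb, hne', e', e''⟩ := H l r h
    obtain ⟨rfl, rfl⟩ := two (by omega) h' (by omega) e e' hne hne'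
    exact ⟨by omega, e''⟩
  intro l
  obtain ⟨l', r', h', hne, e, -⟩ := H l 0 (by omega)
  -- Otherwise an edge enters this vertex along `l'`, and the end of its twin is a third slot with
  -- the same value: it is neither `(l', r')` nor the initial slot of `l`.
  have hr' : r' = 0 := by
    by_contra hr
    obtain ⟨s, rfl⟩ := Nat.exists_eq_succ_of_ne_zero hr
    obtain ⟨a, b, hb, hne', -, e'⟩ := H l' s (by omega)
    have := two (l := l') (r := s + 1) (l' := l) (r' := 0) (l'' := a) (r'' := b + 1)
      (by omega) (by omega) (by omega) e.symm e' (fun h => by omega) (by simpa using hne')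
    omega
  subst hr'
  have hll : l' ≠ l := fun h => hne ⟨h, rfl⟩
  have agree : ∀ r (h : r < (J l : ℕ) + 1 + 1), ∃ h' : r < (J l' : ℕ) + 1 + 1,
      f l' ⟨r, h'⟩ = f l ⟨r, h⟩ := by
    intro r
    induction r with
    | zero => exact fun _ => ⟨by omega, e⟩
    | succ r ih =>
      intro h
      obtain ⟨h1, h2⟩ := ih (by omega)
      exact step (by omega) h1 h2 fun h => hll h.1
  have agree' : ∀ r (h : r < (J l' : ℕ) + 1 + 1), ∃ h' : r < (J l : ℕ) + 1 + 1,
      f l ⟨r, h'⟩ = f l' ⟨r, h⟩ := by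
    intro r
    induction r with
    | zero => exact fun _ => ⟨by omega, e.symm⟩
    | succ r ih =>
      intro h
      obtain ⟨h1, h2⟩ := ih (by omega)
      exact step (by omega) h1 h2 fun h => hll h.1.symm
  refine ⟨l', hll, pathLabel_eq_iff.2 ⟨Fin.ext ?_, fun r h h' => (agree r h').2⟩⟩
  -- Each path contains the last position of the other, so the lengths agree.
  obtain ⟨h1, -⟩ := agree ((J l : ℕ) + 1) (by omega)
  obtain ⟨h2, -⟩ := agree' ((J l' : ℕ) + 1) (by omega)
  omega

variable [Fintype ι]

/-- Both sides are 1 when edges, equivalently paths, are paired, and 0 otherwise; only the first two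
moments of `ν` and `ν'` enter. -/
lemma labelledMoment_pathEdge_eq_pathLabel {ν ν' : Measure ℝ} (h1 : ∫ t, t ∂ν = 0)
    (h2 : ∫ t, t ^ 2 ∂ν = 1) (h1' : ∫ t, t ∂ν' = 0) (h2' : ∫ t, t ^ 2 ∂ν' = 1)
    (H : HasTwins (pathVertex J f) → AtMostTwoToOne (pathVertex J f)) :
    labelledMoment ν (pathEdge J f) = labelledMoment ν' (pathLabel J f) := by
  by_cases hE : HasTwins (pathEdge J f)
  · have hV := H hE.pathVertex_of_pathEdge
    rw [labelledMoment_eq_one h2 hE hV.pathEdge,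
      labelledMoment_eq_one h2' (hE.pathLabel_of_pathEdge hV) hV.pathLabel]
  · rw [labelledMoment_eq_zero h1 hE,
      labelledMoment_eq_zero h1' fun hL => hE hL.pathEdge_of_pathLabel]

end

/-! ### Counting the exceptional families. -/

-- A map with at most `d` values factors through `Fin d`.
open Classical in
lemma card_filter_card_image_le {E V : Type*} [Fintype E] [Nonempty E] [Fintype V] (d : ℕ) :
    (Finset.univ.filter fun f : E → V => (Finset.univ.image f).card ≤ d).card ≤
      d ^ Fintype.card E * Fintype.card V ^ d := by
  have h : (Finset.univ : Finset ((E → Fin d) × (Fin d → V))).card =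
      d ^ Fintype.card E * Fintype.card V ^ d := by simp
  rw [← h]
  refine Finset.card_le_card_of_surjOn (fun p => p.2 ∘ p.1) fun f hf => ?_
  simp only [Finset.coe_filter, Finset.mem_univ, true_and, Set.mem_ofPred_eq] at hf
  rw [Finset.coe_univ, Set.image_univ]
  obtain ⟨e⟩ := ‹Nonempty E›
  obtain ⟨g⟩ : Nonempty (Finset.univ.image f ↪ Fin d) :=
    Function.Embedding.nonempty_of_card_le (by rwa [Fintype.card_coe, Fintype.card_fin])
  refine ⟨(fun e => g ⟨f e, by simp⟩, Function.extend g Subtype.val fun _ => f e), ?_⟩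
  funext e'
  simp only [Function.comp_apply]
  rw [g.injective.extend_apply]

open Classical in
/-- The families of paths with a vertex value taken three times and none taken once are
negligible. -/
lemma card_not_atMostTwoToOne_mul_le {ι : Type*} [Fintype ι] {m : ℕ} (J : ι → Fin m) (n : ℕ) :
    ((Finset.univ.filter fun f : ∀ l, Fin ((J l : ℕ) + 1 + 1) → Fin n =>
        ¬ (HasTwins (pathVertex J f) → AtMostTwoToOne (pathVertex J f))).card : ℝ) *
      (1 / √(n : ℝ)) ^ (∑ l, ((J l : ℕ) + 1 + 1)) ≤
      ((∑ l, ((J l : ℕ) + 1 + 1) : ℕ) : ℝ) ^ (∑ l, ((J l : ℕ) + 1 + 1)) * (1 / √(n : ℝ)) := by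
  set N := ∑ l, ((J l : ℕ) + 1 + 1) with hN
  have hcard : Fintype.card (Σ l, Fin ((J l : ℕ) + 1 + 1)) = N := by simp [hN]
  rcases isEmpty_or_nonempty (Σ l, Fin ((J l : ℕ) + 1 + 1)) with hE | hE
  · have h0 : ∀ f : ∀ l, Fin ((J l : ℕ) + 1 + 1) → Fin n,
        HasTwins (pathVertex J f) → AtMostTwoToOne (pathVertex J f) :=
      fun f _ a => isEmptyElim a
    rw [Finset.card_eq_zero.2 (Finset.filter_eq_empty_iff.2 fun f _ => not_not.2 (h0 f)),
      Nat.cast_zero, zero_mul]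
    positivity
  have hN0 : 0 < N := hcard ▸ Fintype.card_pos
  -- For `n = 0` the convention `1 / 0 = 0` makes both sides vanish.
  rcases n.eq_zero_or_pos with rfl | hn
  · simp [hN0.ne']
  -- The largest possible number of distinct vertices: all values repeat and one occurs three times.
  -- Since `2 * d + 1 ≤ N`, one factor `1 / √n` is left over.
  set d := (N - 1) / 2 with hd
  have hle : (Finset.univ.filter fun f : ∀ l, Fin ((J l : ℕ) + 1 + 1) → Fin n =>
      ¬ (HasTwins (pathVertex J f) → AtMostTwoToOne (pathVertex J f))).card ≤ N ^ N * n ^ d := by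
    refine le_trans (Finset.card_le_card_of_injOn (pathVertex J) (fun f hf => ?_)
      (fun f _ f' _ h => ?_)) ((card_filter_card_image_le (V := Fin n)
        (E := Σ l, Fin ((J l : ℕ) + 1 + 1)) d).trans ?_)
    · simp only [Finset.coe_filter, Finset.mem_univ, true_and, Set.mem_ofPred_eq,
        Classical.not_imp] at hf ⊢
      have h := two_mul_card_image_lt hf.1 hf.2
      have h' : (Finset.univ.image (pathVertex J f)).card ≤ d := by omega
      convert h'
    · funext l r
      exact congrFun h ⟨l, r⟩
    · rw [hcard, Fintype.card_fin]
      gcongr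
      omega
  have hs : (0 : ℝ) < √(n : ℝ) := Real.sqrt_pos.2 (by exact_mod_cast hn)
  have hs1 : (1 / √(n : ℝ)) ≤ 1 := by
    rw [div_le_one hs]
    exact Real.one_le_sqrt.2 (by exact_mod_cast hn)
  have hnd : (n : ℝ) ^ d * (1 / √(n : ℝ)) ^ (2 * d) = 1 := by
    rw [pow_mul, div_pow, Real.sq_sqrt (Nat.cast_nonneg n), ← mul_pow, one_pow,
      mul_one_div_cancel (by exact_mod_cast hn.ne'), one_pow]
  calc _ ≤ ((N ^ N * n ^ d : ℕ) : ℝ) * (1 / √(n : ℝ)) ^ (2 * d + 1) := by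
        gcongr ?_ * ?_
        · exact_mod_cast hle
        · exact pow_le_pow_of_le_one (by positivity) hs1 (by omega)
    _ = (N : ℝ) ^ N * ((n : ℝ) ^ d * (1 / √(n : ℝ)) ^ (2 * d)) * (1 / √(n : ℝ)) := by
        push_cast
        ring
    _ = _ := by rw [hnd, mul_one]

/-! ### Path expansions of matrix powers and of moments. -/

section
variable {V : Type*} [Fintype V]

lemma dotProduct_pow_mulVec_eq_sum_paths [DecidableEq V] (A : Matrix V V ℝ) (u : V → ℝ) (j : ℕ) :
    ∀ w : V → ℝ, w ⬝ᵥ ((A ^ j).mulVec u) = ∑ q : Fin (j + 1) → V,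
      w (q 0) * (∏ r : Fin j, A (q r.castSucc) (q r.succ)) * u (q (Fin.last j)) := by
  induction j with
  | zero =>
    intro w
    rw [← (Equiv.funUnique (Fin 1) V).symm.sum_comp]
    simp [dotProduct]
  | succ j ih =>
    intro w
    -- One factor is absorbed into `w`, which is why `w` is general in the induction; paths then
    -- grow at the front.
    rw [pow_succ', ← Matrix.mulVec_mulVec, Matrix.dotProduct_mulVec, ih]
    refine Eq.trans ?_ ((Fin.consEquiv fun _ : Fin (j + 1 + 1) => V).sum_comp _)
    rw [Fintype.sum_prod_type_right]
    refine Finset.sum_congr rfl fun q _ => ?_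
    simp only [Matrix.vecMul, dotProduct, Finset.sum_mul]
    refine Finset.sum_congr rfl fun a _ => ?_
    simp only [Fin.consEquiv_apply, Fin.prod_univ_succ, Fin.castSucc_zero, Fin.cons_zero,
      Fin.cons_succ, ← Fin.succ_castSucc, ← Fin.succ_last]
    ring

lemma sum_paths_endpoints (a b : V → ℝ) (j : ℕ) :
    ∑ q : Fin (j + 1 + 1) → V, a (q 0) * b (q (Fin.last (j + 1))) =
      (∑ i, a i) * (Fintype.card V : ℝ) ^ j * ∑ i, b i := by
  -- The `j` interior vertices carry weight 1 and are summed freely.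
  let c : Fin (j + 1 + 1) → V → ℝ := Fin.cons a (Fin.snoc (α := fun _ => V → ℝ) (fun _ _ => 1) b)
  have h := Finset.prod_univ_sum (fun _ : Fin (j + 1 + 1) => (Finset.univ : Finset V)) c
  rw [Fintype.piFinset_univ] at h
  simp only [Fin.prod_univ_succ (n := j + 1), Fin.prod_univ_castSucc (n := j), c, Fin.cons_zero,
    Fin.cons_succ, Fin.snoc_castSucc, Fin.snoc_last, Finset.prod_const_one, Finset.sum_const,
    Finset.card_univ, nsmul_eq_mul, mul_one, one_mul, Finset.prod_const, Fintype.card_fin,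
    Fin.succ_last] at h
  rw [← h, mul_assoc]
end

section
variable {V : Type*} [Fintype V] {m : ℕ}

/-- The polynomial `∑ w(q) ∏ y(e)`, over paths `q` and the product over the edges `e` of `q`. -/
noncomputable def pathPolynomial (w : ∀ j : Fin m, (Fin ((j : ℕ) + 1 + 1) → V) → ℝ)
    (y : V × V → ℝ) : ℝ :=
  ∑ j, ∑ q, w j q * ∏ r : Fin ((j : ℕ) + 1), y (q r.castSucc, q r.succ)

/-- The linear form `∑ w(q) g(q)` over paths `q`. -/
noncomputable def pathLinearForm (w : ∀ j : Fin m, (Fin ((j : ℕ) + 1 + 1) → V) → ℝ)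
    (g : (Σ j : Fin m, (Fin ((j : ℕ) + 1 + 1) → V)) → ℝ) : ℝ :=
  ∑ j, ∑ q, w j q * g ⟨j, q⟩

lemma sum_sum_pow_eq (h : ∀ j : Fin m, (Fin ((j : ℕ) + 1 + 1) → V) → ℝ) (k : ℕ) :
    (∑ j, ∑ q, h j q) ^ k =
      ∑ J : Fin k → Fin m, ∑ f : ∀ l, Fin ((J l : ℕ) + 1 + 1) → V, ∏ l, h (J l) (f l) := by
  classical
  rw [← Fin.prod_const, Fintype.prod_sum]
  exact Finset.sum_congr rfl fun J _ => Fintype.prod_sum _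

lemma pathPolynomial_pow (w : ∀ j : Fin m, (Fin ((j : ℕ) + 1 + 1) → V) → ℝ) (y : V × V → ℝ)
    (k : ℕ) : pathPolynomial w y ^ k =
      ∑ J : Fin k → Fin m, ∑ f : ∀ l, Fin ((J l : ℕ) + 1 + 1) → V,
        (∏ l, w (J l) (f l)) * ∏ e, y (pathEdge J f e) := by
  rw [pathPolynomial, sum_sum_pow_eq]
  refine Finset.sum_congr rfl fun J _ => Finset.sum_congr rfl fun f _ => ?_
  rw [Finset.prod_mul_distrib, Fintype.prod_sigma]
  rfl

lemma pathLinearForm_pow (w : ∀ j : Fin m, (Fin ((j : ℕ) + 1 + 1) → V) → ℝ)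
    (g : (Σ j : Fin m, (Fin ((j : ℕ) + 1 + 1) → V)) → ℝ) (k : ℕ) : pathLinearForm w g ^ k =
      ∑ J : Fin k → Fin m, ∑ f : ∀ l, Fin ((J l : ℕ) + 1 + 1) → V,
        (∏ l, w (J l) (f l)) * ∏ l, g (pathLabel J f l) := by
  rw [pathLinearForm, sum_sum_pow_eq]
  refine Finset.sum_congr rfl fun J _ => Finset.sum_congr rfl fun f _ => ?_
  rw [Finset.prod_mul_distrib]
  rfl

section
variable {Ω : Type*} [MeasurableSpace Ω] {P : Measure Ω} [IsProbabilityMeasure P] {ν : Measure ℝ}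
  {Y : V × V → Ω → ℝ} (w : ∀ j : Fin m, (Fin ((j : ℕ) + 1 + 1) → V) → ℝ) (k : ℕ)

lemma integrable_pathPolynomial_pow (hY : ∀ q, HasLaw (Y q) ν P)
    (hν : ∀ k : ℕ, Integrable (fun t : ℝ => |t| ^ k) ν) :
    Integrable (fun ω => pathPolynomial w (fun p => Y p ω) ^ k) P := by
  simp_rw [pathPolynomial_pow]
  exact integrable_finsetSum _ fun J _ => integrable_finsetSum _ fun f _ =>
    (integrable_prod_comp hY hν _).const_mul _

lemma integral_pathPolynomial_pow (hY : ∀ q, HasLaw (Y q) ν P) (hind : iIndepFun Y P)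
    (hν : ∀ k : ℕ, Integrable (fun t : ℝ => |t| ^ k) ν) :
    ∫ ω, pathPolynomial w (fun p => Y p ω) ^ k ∂P =
      ∑ J : Fin k → Fin m, ∑ f : ∀ l, Fin ((J l : ℕ) + 1 + 1) → V,
        (∏ l, w (J l) (f l)) * labelledMoment ν (pathEdge J f) := by
  simp_rw [pathPolynomial_pow]
  rw [integral_finsetSum _ fun J _ => integrable_finsetSum _ fun f _ =>
    (integrable_prod_comp hY hν _).const_mul _]
  refine Finset.sum_congr rfl fun J _ => ?_
  rw [integral_finsetSum _ fun f _ => (integrable_prod_comp hY hν _).const_mul _]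
  refine Finset.sum_congr rfl fun f _ => ?_
  rw [integral_const_mul, integral_prod_comp_eq_labelledMoment hY hind]

lemma integral_pathLinearForm_pow
    {G : (Σ j : Fin m, (Fin ((j : ℕ) + 1 + 1) → V)) → Ω → ℝ}
    (hG : ∀ q, HasLaw (G q) ν P) (hind : iIndepFun G P)
    (hν : ∀ k : ℕ, Integrable (fun t : ℝ => |t| ^ k) ν) :
    ∫ ω, pathLinearForm w (fun p => G p ω) ^ k ∂P =
      ∑ J : Fin k → Fin m, ∑ f : ∀ l, Fin ((J l : ℕ) + 1 + 1) → V,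
        (∏ l, w (J l) (f l)) * labelledMoment ν (pathLabel J f) := by
  simp_rw [pathLinearForm_pow]
  rw [integral_finsetSum _ fun J _ => integrable_finsetSum _ fun f _ =>
    (integrable_prod_comp hG hν _).const_mul _]
  refine Finset.sum_congr rfl fun J _ => ?_
  rw [integral_finsetSum _ fun f _ => (integrable_prod_comp hG hν _).const_mul _]
  refine Finset.sum_congr rfl fun f _ => ?_
  rw [integral_const_mul, integral_prod_comp_eq_labelledMoment hG hind]
end
end

/-! ### Comparison of moments. -/

/-- Up to `O(1/√n)`, the moments of a delocalised path polynomial are those of the linear form. -/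
lemma exists_abs_sum_labelledMoment_sub_le {ν ν' : Measure ℝ} (h1 : ∫ t, t ∂ν = 0)
    (h2 : ∫ t, t ^ 2 ∂ν = 1) (h1' : ∫ t, t ∂ν' = 0) (h2' : ∫ t, t ^ 2 ∂ν' = 1) (m k : ℕ)
    {D : ℝ} (hD : 0 ≤ D) : ∃ K : ℝ, ∀ (n : ℕ)
      (w : ∀ j : Fin m, (Fin ((j : ℕ) + 1 + 1) → Fin n) → ℝ),
      (∀ j q, |w j q| ≤ D * (1 / √(n : ℝ)) ^ ((j : ℕ) + 1 + 1)) →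
      |(∑ J : Fin k → Fin m, ∑ f : ∀ l, Fin ((J l : ℕ) + 1 + 1) → Fin n,
          (∏ l, w (J l) (f l)) * labelledMoment ν (pathEdge J f)) -
        ∑ J : Fin k → Fin m, ∑ f : ∀ l, Fin ((J l : ℕ) + 1 + 1) → Fin n,
          (∏ l, w (J l) (f l)) * labelledMoment ν' (pathLabel J f)| ≤ K * (1 / √(n : ℝ)) := by
  classical
  choose B hB0 hB using fun J : Fin k → Fin m =>
    abs_labelledMoment_le.{0, 0} (Σ l, Fin ((J l : ℕ) + 1)) ν
  obtain ⟨B', hB0', hB'⟩ := abs_labelledMoment_le.{0, 0} (Fin k) ν'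
  refine ⟨∑ J : Fin k → Fin m, D ^ k * (B J + B') *
    ((∑ l, ((J l : ℕ) + 1 + 1) : ℕ) : ℝ) ^ (∑ l, ((J l : ℕ) + 1 + 1)), fun n w hw => ?_⟩
  rw [← Finset.sum_sub_distrib, Finset.sum_mul]
  refine (Finset.abs_sum_le_sum_abs _ _).trans (Finset.sum_le_sum fun J _ => ?_)
  rw [← Finset.sum_sub_distrib]
  set N := ∑ l, ((J l : ℕ) + 1 + 1) with hN
  set bad := Finset.univ.filter fun f : ∀ l, Fin ((J l : ℕ) + 1 + 1) → Fin n =>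
        ¬ (HasTwins (pathVertex J f) → AtMostTwoToOne (pathVertex J f)) with hbad
  -- Outside `bad` the two terms cancel exactly.
  rw [← Finset.sum_subset (Finset.subset_univ bad) fun f _ hf => by
    rw [labelledMoment_pathEdge_eq_pathLabel h1 h2 h1' h2' (by simpa [hbad] using hf), sub_self]]
  have hterm : ∀ f ∈ bad, |(∏ l, w (J l) (f l)) * labelledMoment ν (pathEdge J f) -
      (∏ l, w (J l) (f l)) * labelledMoment ν' (pathLabel J f)| ≤
      D ^ k * (B J + B') * (1 / √(n : ℝ)) ^ N := by
    intro f _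
    rw [← mul_sub, abs_mul, Finset.abs_prod, mul_right_comm]
    have hp : ∏ l, |w (J l) (f l)| ≤ D ^ k * (1 / √(n : ℝ)) ^ N := by
      refine (Finset.prod_le_prod (fun _ _ => abs_nonneg _) fun l _ => hw (J l) (f l)).trans ?_
      rw [Finset.prod_mul_distrib, Finset.prod_pow_eq_pow_sum, Fin.prod_const]
    exact mul_le_mul hp ((abs_sub _ _).trans (add_le_add (hB J _) (hB' _))) (abs_nonneg _)
      (by positivity)
  calc _ ≤ ∑ f ∈ bad, D ^ k * (B J + B') * (1 / √(n : ℝ)) ^ N :=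
        (Finset.abs_sum_le_sum_abs _ _).trans (Finset.sum_le_sum hterm)
    _ = D ^ k * (B J + B') * (bad.card * (1 / √(n : ℝ)) ^ N) := by
        rw [Finset.sum_const, nsmul_eq_mul]
        ring
    _ ≤ D ^ k * (B J + B') * ((N : ℝ) ^ N * (1 / √(n : ℝ))) := by
        have := hB0 J
        gcongr ?_ * ?_
        convert! card_not_atMostTwoToOne_mul_le J n
    _ = _ := by ring

/-! ### The Gaussian linear form. -/

lemma map_sum_mul_pi_gaussianReal {ι : Type*} [Fintype ι] (c : ι → ℝ) :
    (Measure.pi fun _ : ι => gaussianReal 0 1).map (fun g => ∑ a, c a * g a) =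
      gaussianReal 0 (∑ a, c a ^ 2).toNNReal := by
  have hind : iIndepFun (fun (a : ι) (g : ι → ℝ) => c a * g a)
      (Measure.pi fun _ : ι => gaussianReal 0 1) :=
    iIndepFun_pi (X := fun a (y : ℝ) => c a * y) fun a => by fun_prop
  have : IsProbabilityMeasure ((Measure.pi fun _ : ι => gaussianReal 0 1).map
      (fun g => ∑ a, c a * g a)) := Measure.isProbabilityMeasure_map
      (by fun_prop : Measurable fun g : ι → ℝ => ∑ a, c a * g a).aemeasurable
  refine Measure.ext_of_charFun ?_
  rw [hind.charFun_map_fun_sum_eq_prod fun a =>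
    (by fun_prop : Measurable fun g : ι → ℝ => c a * g a).aemeasurable]
  funext s
  have hlaw : ∀ a, (Measure.pi fun _ : ι => gaussianReal 0 1).map (fun g => c a * g a) =
      gaussianReal 0 (NNReal.mk (c a ^ 2) (sq_nonneg _)) := by
    intro a
    have := gaussianReal_map_const_mul (μ := 0) (v := 1) (c a)
    rw [mul_zero, mul_one] at this
    rw [← (measurePreserving_eval (fun _ : ι => gaussianReal 0 1) a).map_eq,
      Measure.map_map (by fun_prop) (by fun_prop)] at this
    exact this
  simp only [Finset.prod_apply, hlaw, charFun_gaussianReal, ← Complex.exp_sum]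
  congr 1
  rw [Real.coe_toNNReal _ (Finset.sum_nonneg fun _ _ => sq_nonneg _)]
  simp [← Finset.sum_div, ← Finset.sum_mul]

lemma integral_sq_gaussianReal_zero_one : ∫ t, t ^ 2 ∂(gaussianReal 0 1) = 1 := by
  have h := variance_fun_id_gaussianReal (μ := 0) (v := 1)
  rw [variance_eq_integral (by fun_prop)] at h
  simpa using h

lemma integrable_exp_abs_gaussianReal (v : NNReal) :
    Integrable (fun y : ℝ => Real.exp |y|) (gaussianReal 0 v) := by
  have h := (integrable_exp_mul_gaussianReal (μ := 0) (v := v) 1).add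
    (integrable_exp_mul_gaussianReal (μ := 0) (v := v) (-1))
  refine h.mono' (by fun_prop) (ae_of_all _ fun y => ?_)
  rw [Real.norm_of_nonneg (Real.exp_nonneg _)]
  simp only [Pi.add_apply, one_mul, neg_mul]
  rcases abs_cases y with ⟨h, -⟩ | ⟨h, -⟩ <;> rw [h]
  · exact le_add_of_nonneg_right (Real.exp_nonneg _)
  · exact le_add_of_nonneg_left (Real.exp_nonneg _)

lemma integrable_abs_pow_gaussianReal (v : NNReal) (k : ℕ) :
    Integrable (fun y : ℝ => |y| ^ k) (gaussianReal 0 v) := by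
  refine ((integrable_exp_abs_gaussianReal v).const_mul (k.factorial : ℝ)).mono' (by fun_prop)
    (ae_of_all _ fun y => ?_)
  rw [Real.norm_of_nonneg (by positivity), ← div_le_iff₀' (by positivity)]
  exact Real.pow_div_factorial_le_exp _ (abs_nonneg y) k

/-- The combinatorial sum is the moment of a linear form in independent Gaussians, one per path,
whose law is known exactly. -/
lemma integral_pathLinearForm_pow_gaussianReal {V : Type*} [Fintype V] {m : ℕ}
    (w : ∀ j : Fin m, (Fin ((j : ℕ) + 1 + 1) → V) → ℝ) (k : ℕ) :
    ∑ J : Fin k → Fin m, ∑ f : ∀ l, Fin ((J l : ℕ) + 1 + 1) → V,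
        (∏ l, w (J l) (f l)) * labelledMoment (gaussianReal 0 1) (pathLabel J f) =
      ∫ y, y ^ k ∂(gaussianReal 0 (∑ j, ∑ q, w j q ^ 2).toNNReal) := by
  have h := map_sum_mul_pi_gaussianReal
    fun a : Σ j : Fin m, (Fin ((j : ℕ) + 1 + 1) → V) => w a.1 a.2
  rw [Fintype.sum_sigma] at h
  rw [← h, integral_map (by fun_prop : Measurable fun
      g : (Σ j : Fin m, (Fin ((j : ℕ) + 1 + 1) → V)) → ℝ =>
        ∑ a, w a.1 a.2 * g a).aemeasurable (by fun_prop), ← integral_pathLinearForm_pow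
    (P := Measure.pi fun _ : (Σ j : Fin m, (Fin ((j : ℕ) + 1 + 1) → V)) => gaussianReal 0 1)
    (G := fun a g => g a) w k (fun a => ?_) ?_ (integrable_abs_pow_gaussianReal 1)]
  · simp only [pathLinearForm, Fintype.sum_sigma]
  · exact iIndepFun_pi (X := fun _ (y : ℝ) => y) fun a => by fun_prop
  · exact ⟨(measurable_pi_apply a).aemeasurable, (measurePreserving_eval _ a).map_eq⟩

/-! ### Size and total variance of the path weights. -/

/-- The weight of a path in `√n ⟨(X_n / √n)^j u, v⟩`. -/
noncomputable def pathWeight {m n : ℕ} (t : Fin m → ℝ) (a b : Fin n → ℝ) (j : Fin m)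
    (q : Fin ((j : ℕ) + 1 + 1) → Fin n) : ℝ :=
  t j * (√(n : ℝ) * (1 / √(n : ℝ)) ^ ((j : ℕ) + 1) * (b (q 0) * a (q (Fin.last _))))

section
variable {m n : ℕ} (t : Fin m → ℝ) {a b : Fin n → ℝ}

/-- The scaling `n * n^{-(j+1)}` cancels the `n^j` choices of interior vertices. -/
lemma sum_pathWeight_sq (hn : 1 ≤ n) (ha : ∑ i, a i ^ 2 = 1) (hb : ∑ i, b i ^ 2 = 1) :
    ∑ j, ∑ q, pathWeight t a b j q ^ 2 = ∑ j, t j ^ 2 := by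
  refine Finset.sum_congr rfl fun j _ => ?_
  have hn' : (n : ℝ) ≠ 0 := by exact_mod_cast (by omega : n ≠ 0)
  simp only [pathWeight, mul_pow]
  rw [← Finset.mul_sum, ← Finset.mul_sum, sum_paths_endpoints (fun i => b i ^ 2)
    (fun i => a i ^ 2), ha, hb, Real.sq_sqrt (Nat.cast_nonneg n), ← pow_mul, mul_comm _ 2, pow_mul,
    div_pow, Real.sq_sqrt (Nat.cast_nonneg n), Fintype.card_fin, one_pow, one_div, inv_pow]
  field_simp
  ring

lemma abs_pathWeight_le {C : ℝ} (ha : ∀ i, |a i| ≤ C / √(n : ℝ))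
    (hb : ∀ i, |b i| ≤ C / √(n : ℝ)) (j : Fin m) (q : Fin ((j : ℕ) + 1 + 1) → Fin n) :
    |pathWeight t a b j q| ≤ (∑ j, |t j|) * C ^ 2 * (1 / √(n : ℝ)) ^ ((j : ℕ) + 1 + 1) := by
  have hn : 0 < n := (q 0).pos
  have hs : 0 < √(n : ℝ) := Real.sqrt_pos.2 (by exact_mod_cast hn)
  have ht : |t j| ≤ ∑ j, |t j| :=
    Finset.single_le_sum (f := fun j => |t j|) (fun _ _ => abs_nonneg _) (Finset.mem_univ j)
  have hab : |b (q 0)| * |a (q (Fin.last _))| ≤ (C / √(n : ℝ)) * (C / √(n : ℝ)) :=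
    mul_le_mul (hb _) (ha _) (abs_nonneg _) ((abs_nonneg _).trans (hb (q 0)))
  have hpos : 0 ≤ √(n : ℝ) * (1 / √(n : ℝ)) ^ ((j : ℕ) + 1) := by positivity
  rw [pathWeight, abs_mul, abs_mul, abs_of_nonneg hpos, abs_mul]
  calc _ ≤ (∑ j, |t j|) * (√(n : ℝ) * (1 / √(n : ℝ)) ^ ((j : ℕ) + 1) *
        ((C / √(n : ℝ)) * (C / √(n : ℝ)))) := by gcongr
    _ = _ := by
        rw [pow_succ (1 / √(n : ℝ)) ((j : ℕ) + 1)]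
        field_simp

end

/-! ### Convergence of the scaled coefficients. -/

section
variable {Ω : Type*} {x : ℕ → ℕ → Ω → ℝ} {u v : (n : ℕ) → EuclideanSpace ℝ (Fin n)} {m : ℕ}

lemma scaledCoefficient_eq_sum (j n : ℕ) (ω : Ω) : scaledCoefficient x u v j n ω =
    ∑ q : Fin (j + 1) → Fin n, √(n : ℝ) * (1 / √(n : ℝ)) ^ j *
      (v n (q 0) * u n (q (Fin.last j))) * ∏ r : Fin j, x (q r.castSucc) (q r.succ) ω := by
  have h : inner ℝ (Matrix.toEuclideanLin (((1 / √(n : ℝ)) • cornerMatrix x n ω) ^ j) (u n)) (v n) =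
      (v n).ofLp ⬝ᵥ ((((1 / √(n : ℝ)) • cornerMatrix x n ω) ^ j).mulVec (u n).ofLp) := by
    rw [EuclideanSpace.inner_eq_star_dotProduct, star_trivial, Matrix.toLpLin_apply]
  rw [scaledCoefficient, h, dotProduct_pow_mulVec_eq_sum_paths, Finset.mul_sum]
  refine Finset.sum_congr rfl fun q _ => ?_
  simp only [Matrix.smul_apply, cornerMatrix, Matrix.of_apply, smul_eq_mul,
    Finset.prod_mul_distrib, Finset.prod_const, Finset.card_univ, Fintype.card_fin]
  ring

lemma sum_mul_scaledCoefficient_eq (t : Fin m → ℝ) (n : ℕ) (ω : Ω) :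
    ∑ j : Fin m, t j * scaledCoefficient x u v ((j : ℕ) + 1) n ω =
      pathPolynomial (pathWeight t (u n) (v n)) (fun p => x p.1 p.2 ω) := by
  refine Finset.sum_congr rfl fun j _ => ?_
  rw [scaledCoefficient_eq_sum, Finset.mul_sum]
  refine Finset.sum_congr rfl fun q _ => ?_
  rw [pathWeight, mul_assoc (t j)]

variable [MeasurableSpace Ω] {P : Measure Ω} {ν : Measure ℝ}

lemma aemeasurable_scaledCoefficient (hx : IsIIDRandomMatrix P x ν) (j n : ℕ) :
    AEMeasurable (scaledCoefficient x u v j n) P := by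
  have h : ∀ i k, AEMeasurable (x i k) P := fun i k => (hx.hasLaw i k).aemeasurable
  rw [show scaledCoefficient x u v j n = _ from funext (scaledCoefficient_eq_sum j n)]
  fun_prop

lemma sum_sq_ofLp_eq_one {n : ℕ} {a : EuclideanSpace ℝ (Fin n)} (ha : ‖a‖ = 1) :
    ∑ i, a i ^ 2 = 1 := by
  rw [← EuclideanSpace.real_norm_sq_eq, ha, one_pow]

/-- The characteristic functions of the linear combinations converge to the Gaussian ones. -/
lemma tendsto_integral_cexp_sum_scaledCoefficient [IsProbabilityMeasure P] (hx : IsIIDRandomMatrix P x ν)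
    (hmoments : ∀ k : ℕ, Integrable (fun t : ℝ => |t| ^ k) ν)
    (hu : ∀ n : ℕ, 1 ≤ n → ‖u n‖ = 1) (hv : ∀ n : ℕ, 1 ≤ n → ‖v n‖ = 1)
    (hu' : AsymptoticallyDelocalised u) (hv' : AsymptoticallyDelocalised v) (t : Fin m → ℝ) :
    Tendsto (fun n => ∫ ω, Complex.exp
        ((∑ j : Fin m, t j * scaledCoefficient x u v ((j : ℕ) + 1) n ω : ℝ) * Complex.I) ∂P) atTop
      (nhds (∫ y : ℝ, Complex.exp (y * Complex.I) ∂(gaussianReal 0 (∑ j, t j ^ 2).toNNReal))) := by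
  obtain ⟨C₁, hC₁⟩ := hu'
  obtain ⟨C₂, hC₂⟩ := hv'
  have hlaw : ∀ n, ∀ p : Fin n × Fin n, HasLaw (x p.1 p.2) ν P := fun n p => hx.hasLaw _ _
  have hind : ∀ n, iIndepFun (fun p : Fin n × Fin n => x p.1 p.2) P := fun n =>
    hx.indep.precomp (g := fun p : Fin n × Fin n => ((p.1 : ℕ), (p.2 : ℕ)))
      (fun p p' h => Prod.ext (Fin.ext (congrArg Prod.fst h)) (Fin.ext (congrArg Prod.snd h)))
  have hmeas : ∀ j n, AEMeasurable (scaledCoefficient x u v j n) P :=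
    aemeasurable_scaledCoefficient hx
  refine tendsto_integral_cexp_of_tendsto_moments (fun n => by fun_prop) (fun n k => ?_)
    (integrable_exp_abs_gaussianReal _) fun k => ?_
  · simp_rw [sum_mul_scaledCoefficient_eq]
    exact integrable_pathPolynomial_pow _ k (hlaw n) hmoments
  · obtain ⟨K, hK⟩ := exists_abs_sum_labelledMoment_sub_le hx.mean_zero hx.variance_one
      (integral_id_gaussianReal (μ := 0) (v := 1)) integral_sq_gaussianReal_zero_one m k
      (D := (∑ j, |t j|) * (max C₁ C₂) ^ 2)
      (mul_nonneg (Finset.sum_nonneg fun _ _ => abs_nonneg _) (sq_nonneg _))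
    have hsqrt : Tendsto (fun n : ℕ => K * (1 / √(n : ℝ))) atTop (nhds 0) := by
      have h := (tendsto_inv_atTop_zero.comp
        (Real.tendsto_sqrt_atTop.comp tendsto_natCast_atTop_atTop)).const_mul K
      simpa [Function.comp_def] using h
    rw [tendsto_iff_dist_tendsto_zero]
    refine squeeze_zero' (Eventually.of_forall fun _ => dist_nonneg) ?_ hsqrt
    -- For these `n` the limiting variance is attained exactly, so only the comparison error
    -- remains.
    filter_upwards [eventually_ge_atTop 1] with n hn
    have h := hK n (pathWeight t (u n) (v n)) (abs_pathWeight_le t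
      (fun i => (hC₁ n i).trans (by gcongr; exact le_max_left _ _))
      (fun i => (hC₂ n i).trans (by gcongr; exact le_max_right _ _)))
    rw [integral_pathLinearForm_pow_gaussianReal, sum_pathWeight_sq t hn
      (sum_sq_ofLp_eq_one (hu n hn)) (sum_sq_ofLp_eq_one (hv n hn)),
      ← integral_pathPolynomial_pow _ k (hlaw n) (hind n) hmoments] at h
    simpa only [Real.dist_eq, sum_mul_scaledCoefficient_eq] using h

end

theorem mainTheorem6 {Ω : Type*} [MeasurableSpace Ω] (P : Measure Ω) [IsProbabilityMeasure P]
    (x : ℕ → ℕ → Ω → ℝ) (ν : Measure ℝ) (hx : IsIIDRandomMatrix P x ν)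
    (hmoments : ∀ k : ℕ, Integrable (fun t : ℝ => |t| ^ k) ν)
    (u v : (n : ℕ) → EuclideanSpace ℝ (Fin n))
    (hu : ∀ n : ℕ, 1 ≤ n → ‖u n‖ = 1) (hv : ∀ n : ℕ, 1 ≤ n → ‖v n‖ = 1)
    (hu' : AsymptoticallyDelocalised u) (hv' : AsymptoticallyDelocalised v)
    (m : ℕ) (hm : 1 ≤ m) :
    TendstoInDistribution
      (fun (n : ℕ) (ω : Ω) (j : Fin m) => scaledCoefficient x u v ((j : ℕ) + 1) n ω)
      atTop (id : (Fin m → ℝ) → (Fin m → ℝ))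
      (fun _ => P) (Measure.pi fun _ : Fin m => gaussianReal 0 1) := by
  have hmeas : ∀ n, AEMeasurable
      (fun (ω : Ω) (j : Fin m) => scaledCoefficient x u v ((j : ℕ) + 1) n ω) P :=
    fun n => aemeasurable_pi_lambda _ fun j => aemeasurable_scaledCoefficient hx _ n
  have hmeas' : ∀ n, AEMeasurable (fun ω => WithLp.toLp 2
      fun j : Fin m => scaledCoefficient x u v ((j : ℕ) + 1) n ω) P :=
    fun n => (by fun_prop : Measurable (WithLp.toLp 2 : (Fin m → ℝ) → _)).comp_aemeasurable (hmeas n)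
  -- Lévy's continuity theorem needs an inner product, so convergence is proved in Euclidean space
  -- and pulled back by the continuous map `WithLp.ofLp`.
  have key : TendstoInDistribution (fun (n : ℕ) (ω : Ω) => WithLp.toLp 2
      fun j : Fin m => scaledCoefficient x u v ((j : ℕ) + 1) n ω) atTop
      (WithLp.toLp 2 : (Fin m → ℝ) → EuclideanSpace ℝ (Fin m))
      (fun _ => P) (Measure.pi fun _ : Fin m => gaussianReal 0 1) := by
    refine ⟨hmeas', by fun_prop, ProbabilityMeasure.tendsto_of_tendsto_charFun fun t => ?_⟩
    have h := tendsto_integral_cexp_sum_scaledCoefficient hx hmoments hu hv hu' hv' t.ofLp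
    convert! h using 1
    · funext n
      simp only [ProbabilityMeasure.coe_mk, charFun_apply]
      rw [integral_map (hmeas' n) (by fun_prop)]
      simp [PiLp.inner_apply]
    · congr 1
      simp only [ProbabilityMeasure.coe_mk]
      -- The frequency `t` is already in the variance, so the one-dimensional function is evaluated
      -- at 1.
      have h1 := charFun_apply_real (μ := gaussianReal 0 (∑ j, t.ofLp j ^ 2).toNNReal) 1
      simp only [Complex.ofReal_one, one_mul] at h1
      rw [charFun_pi, ← h1]
      simp only [charFun_gaussianReal, ← Complex.exp_sum]
      congr 1
      rw [Real.coe_toNNReal _ (Finset.sum_nonneg fun _ _ => sq_nonneg _)]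
      simp [← Finset.sum_div]
  exact key.continuous_comp (g := WithLp.ofLp) (by fun_prop)
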